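/- Let $G$ be a finite simple graph with edge set $E(G)$ that is connected, non-bipartite and $k$-regular, where $k$ is an even integer. Let $g$ be a non-negative integer such that $G$ has odd girth at least $g$, i.e. every odd cycle of $G$ has length at least $g$. For a positive integer $r$, let $rK_2$ denote the disjoint union of $r$ copies of the complete graph $K_2$, and let $\mathrm{KG}(G,rK_2)$ be the graph whose vertices are all subgraphs of $G$ isomorphic to $rK_2$ (the matchings of $G$ with $r$ edges), two of them being adjacent if and only if they are edge-disjoint. Then for every positive integer $r\le \frac{g}{2}$, the chromatic number of this graph is $$\chi(\mathrm{KG}(G,rK_2))=|E(G)|-k(r-1).$$ -/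

import Mathlib

/-- The odd girth of a graph: the length of a shortest cycle of odd length, and `⊤` if there is no
odd cycle, that is, if the graph is bipartite. -/
noncomputable def SimpleGraph.oddGirth {V : Type*} (G : SimpleGraph V) : ℕ∞ :=
  ⨅ (v : V) (c : G.Walk v v) (_ : c.IsCycle) (_ : Odd c.length), (c.length : ℕ∞)

/-- The graph `r K₂`: the disjoint union of `r` copies of the complete graph on two vertices, the
`i`-th copy having the vertices `(i, false)` and `(i, true)`. -/
def copiesK2 (r : ℕ) : SimpleGraph (Fin r × Bool) where
  Adj x y := x.1 = y.1 ∧ x.2 ≠ y.2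
  symm := ⟨fun _ _ h => ⟨h.1.symm, h.2.symm⟩⟩
  loopless := ⟨fun _ h => h.2 rfl⟩

/-- The general Kneser graph `KG(G, F)`: its vertices are the subgraphs of `G` that are isomorphic
to `F`, and two (distinct) vertices are adjacent if the subgraphs are edge-disjoint. If `F` has an
edge then a subgraph isomorphic to `F` is not edge-disjoint from itself, so the clause `S ≠ T` only
matters for edgeless `F`. -/
def generalKneserGraph {V W : Type*} (G : SimpleGraph V) (F : SimpleGraph W) :
    SimpleGraph {S : G.Subgraph // Nonempty (S.coe ≃g F)} where
  Adj S T := S ≠ T ∧ Disjoint S.1.edgeSet T.1.edgeSet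
  symm := ⟨fun _ _ h => ⟨h.1.symm, h.2.symm⟩⟩
  loopless := ⟨fun _ h => h.1 rfl⟩

/-!
The upper bound: there are `r - 1` pairwise nonadjacent vertices, namely every other vertex of a
path on an odd cycle, since a chord between two of them would close an odd cycle shorter than `2 r`
(`SimpleGraph.exists_isIndepSet_card_eq`). Exactly `k (r - 1)` edges touch them, and a matching with
`r` edges has an edge that avoids all of them. Choosing such an edge as the colour of the
matching is a proper colouring (`SimpleGraph.colorable_generalKneserGraph`).

The lower bound is topological. Order the edges along an Eulerian circuit, and let a sign vector
stand for two disjoint sets of edges. If its nonzero entries alternate in sign and there are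
`k (r - 1) + 2` of them, then each of the two sets has `k (r - 1) / 2 + 1` edges, no two of them
consecutive on the circuit (cyclically, as the number of entries is even). A vertex is passed
`k / 2` times, and each passage contributes at most one edge to the set, so the set has maximum
degree at most `k / 2`. If it is bipartite, Hall's theorem yields a matching with `r` edges
(`SimpleGraph.IsBipartite.copiesK2_isContained`); otherwise it contains an odd cycle, which has
length at least `2 r` and contains such a matching as well.

Given a proper colouring with `c` colours, label a sign vector by the length of its longest
alternating subsequence as long as this is at most `k (r - 1) + 1`; longer ones
have matchings with `r` edges in both sign classes, and are labelled by the largest colour of these,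
shifted beyond the labels of the first kind. The sign of a label records which of the two signs
attains the maximum. This labelling is antipodal and has no complementary edges,
so Tucker's lemma (`octahedral_tucker`) bounds the number of edges by the number of labels
(`card_le_of_alternating`), which is the asserted inequality. Tucker's lemma itself follows from
Fan's parity lemma (`sum_posAltLabels_flags`): the number of maximal flags of sign vectors with
positively alternating labels is odd, by induction on the dimension, counting modulo two the
positively alternating facets of the flags in a hemisphere.
-/

open Finset

/-! ### Alternating sets of labels -/

/-- A finite set of integers, listed by increasing absolute value, is positively alternating if
its signs are `+, -, +, …`; the rank of `x` is the number of elements of smaller absolute value. -/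
def PosAlt (T : Finset ℤ) : Prop :=
  ∀ x ∈ T, (0 < x ↔ Even #{y ∈ T | y.natAbs < x.natAbs})

/-- A finite set of integers, listed by increasing absolute value, is negatively alternating if
its signs are `-, +, -, …`. -/
def NegAlt (T : Finset ℤ) : Prop :=
  ∀ x ∈ T, (0 < x ↔ ¬ Even #{y ∈ T | y.natAbs < x.natAbs})

lemma filter_natAbs_lt_insert_of_forall_lt {T : Finset ℤ} {a : ℤ}
    (h : ∀ x ∈ T, x.natAbs < a.natAbs) :
    {y ∈ insert a T | y.natAbs < a.natAbs} = T := by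
  ext y
  simp only [mem_filter, mem_insert]
  constructor
  · rintro ⟨rfl | h1, h2⟩
    · omega
    · exact h1
  · exact fun hy => ⟨Or.inr hy, h y hy⟩

lemma filter_natAbs_lt_insert_of_mem {T : Finset ℤ} {a x : ℤ}
    (h : ∀ x ∈ T, x.natAbs < a.natAbs) (hx : x ∈ T) :
    {y ∈ insert a T | y.natAbs < x.natAbs} = {y ∈ T | y.natAbs < x.natAbs} := by
  have := h x hx
  rw [filter_insert, if_neg (by omega)]

lemma posAlt_insert {T : Finset ℤ} {a : ℤ} (h : ∀ x ∈ T, x.natAbs < a.natAbs) :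
    PosAlt (insert a T) ↔ PosAlt T ∧ (0 < a ↔ Even #T) := by
  unfold PosAlt
  rw [forall_mem_insert, filter_natAbs_lt_insert_of_forall_lt h, and_comm]
  refine and_congr_left fun _ => forall₂_congr fun x hx => ?_
  rw [filter_natAbs_lt_insert_of_mem h hx]

lemma negAlt_insert {T : Finset ℤ} {a : ℤ} (h : ∀ x ∈ T, x.natAbs < a.natAbs) :
    NegAlt (insert a T) ↔ NegAlt T ∧ (0 < a ↔ ¬ Even #T) := by
  unfold NegAlt
  rw [forall_mem_insert, filter_natAbs_lt_insert_of_forall_lt h, and_comm]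
  refine and_congr_left fun _ => forall₂_congr fun x hx => ?_
  rw [filter_natAbs_lt_insert_of_mem h hx]

open Classical in
/-- Modulo two, the number of positively alternating facets of a simplex with pairwise distinct
absolute labels is one if the simplex is itself alternating, and zero otherwise. -/
lemma sum_posAlt_erase (T : Finset ℤ) (hT : Set.InjOn Int.natAbs (T : Set ℤ)) :
    (∑ x ∈ T, if PosAlt (T.erase x) then (1 : ZMod 2) else 0) =
      (if PosAlt T then 1 else 0) + (if NegAlt T then 1 else 0) := by
  induction T using Finset.induction_on_max_value Int.natAbs with
  | empty =>
    simp only [PosAlt, NegAlt, sum_empty, notMem_empty, false_imp_iff, implies_true, if_true]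
    decide
  | insert a T ha hmax ih =>
    have hlt : ∀ x ∈ T, x.natAbs < a.natAbs := fun x hx => by
      refine lt_of_le_of_ne (hmax x hx) fun h => ha ?_
      have := hT (by simp [hx]) (by simp) h
      rwa [← this]
    have ih := ih (hT.mono (by simp))
    rw [sum_insert ha, erase_insert ha, posAlt_insert hlt, negAlt_insert hlt]
    have hterm : ∀ x ∈ T, PosAlt ((insert a T).erase x) ↔
        PosAlt (T.erase x) ∧ (0 < a ↔ ¬ Even #T) := fun x hx => by
      rw [erase_insert_of_ne (by rintro rfl; exact ha hx),
        posAlt_insert fun y hy => hlt y (mem_of_mem_erase hy), ← card_erase_add_one hx,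
        Nat.even_add_one, not_not]
    rw [sum_congr rfl fun x hx => by rw [hterm x hx]]
    have h3 : (0 < a ↔ ¬ Even #T) ↔ ¬ (0 < a ↔ Even #T) := by tauto
    simp only [h3]
    obtain ⟨q, hq⟩ : ∃ q, q = (0 < a ↔ Even #T) := ⟨_, rfl⟩
    simp only [← hq]
    clear hq h3 hterm
    by_cases hq : q
    · simp [hq]
    · simp only [hq, and_true, and_false, if_false, zero_add, not_false_iff]
      rw [ih, ← add_assoc, CharTwo.add_self_eq_zero, zero_add]

/-- The labelling `f` of the vertices of a simplex is injective with positively alternating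
image. -/
def PosAltLabels {n : ℕ} (f : Fin n → ℤ) : Prop :=
  #(univ.image f) = n ∧ PosAlt (univ.image f)

/-- The labelling `f` of the vertices of a simplex is injective with negatively alternating
image. -/
def NegAltLabels {n : ℕ} (f : Fin n → ℤ) : Prop :=
  #(univ.image f) = n ∧ NegAlt (univ.image f)

lemma image_comp_succAbove {n : ℕ} (f : Fin (n + 1) → ℤ) (i : Fin (n + 1)) :
    univ.image (f ∘ i.succAbove) = (univ.erase i).image f := by
  rw [← image_image, Fin.image_succAbove_univ, compl_eq_univ_sdiff, sdiff_singleton_eq_erase]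

open Classical in
/-- If no two labels of a simplex add up to zero, then modulo two its number of positively
alternating facets is one if the simplex itself is alternating, and zero otherwise. -/
lemma sum_posAltLabels_succAbove {n : ℕ} (f : Fin (n + 1) → ℤ) (hf : ∀ i j, f i ≠ - f j) :
    (∑ i : Fin (n + 1), if PosAltLabels (f ∘ i.succAbove) then (1 : ZMod 2) else 0) =
      (if PosAltLabels f then 1 else 0) + (if NegAltLabels f then 1 else 0) := by
  unfold PosAltLabels NegAltLabels
  simp only [image_comp_succAbove]
  by_cases hinj : Function.Injective f
  · have hcard : #(univ.image f) = n + 1 := by rw [card_image_of_injective _ hinj]; simp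
    have hT : Set.InjOn Int.natAbs (univ.image f : Set ℤ) := by
      intro x hx y hy hxy
      simp only [coe_image, coe_univ, Set.image_univ, Set.mem_range] at hx hy
      obtain ⟨i, rfl⟩ := hx
      obtain ⟨j, rfl⟩ := hy
      rcases Int.natAbs_eq_natAbs_iff.1 hxy with h | h
      · exact h
      · exact absurd h (hf i j)
    have := sum_posAlt_erase _ hT
    rw [sum_image hinj.injOn] at this
    simp only [hcard, true_and, ← this]
    refine sum_congr rfl fun i _ => ?_
    rw [image_erase hinj, card_erase_of_mem (by simp), hcard]
    simp
  · have hcard : #(univ.image f) ≠ n + 1 := fun h => hinj <| by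
      have : #(univ.image f) = #(univ : Finset (Fin (n + 1))) := by simpa using h
      exact Set.injOn_univ.1 (by simpa using card_image_iff.1 this)
    simp only [hcard, false_and, if_false, add_zero]
    -- the facets opposite to two equally labelled vertices have the same labels
    simp only [Function.Injective, not_forall] at hinj
    obtain ⟨a, b, hab, hne⟩ := hinj
    change a ≠ b at hne
    have himage : ∀ a b, f a = f b → a ≠ b → (univ.erase a).image f = univ.image f := by
      intro a b hab hne
      refine subset_antisymm (image_subset_image (erase_subset _ _)) fun y hy => ?_
      obtain ⟨i, -, rfl⟩ := mem_image.1 hy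
      by_cases hi : i = a
      · exact mem_image.2 ⟨b, by simp [hne.symm], by rw [hi, hab]⟩
      · exact mem_image.2 ⟨i, by simp [hi], rfl⟩
    rw [sum_eq_add a b hne]
    · rw [himage a b hab hne, himage b a hab.symm hne.symm]
      exact CharTwo.add_self_eq_zero _
    · rintro c - ⟨hca, hcb⟩
      refine if_neg fun h => hne ?_
      have : Set.InjOn f (univ.erase c : Finset (Fin (n + 1))) := by
        rw [← card_image_iff, h.1]; simp
      exact this (by simp [hca.symm]) (by simp [hcb.symm]) hab
    · simp
    · simp

lemma posAlt_image_neg {T : Finset ℤ} (h0 : 0 ∉ T) : PosAlt (T.image Neg.neg) ↔ NegAlt T := by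
  unfold PosAlt NegAlt
  rw [forall_mem_image]
  refine forall₂_congr fun x hx => ?_
  have hx0 : x ≠ 0 := fun h => h0 (h ▸ hx)
  have : #{y ∈ T.image Neg.neg | y.natAbs < (-x).natAbs} = #{y ∈ T | y.natAbs < x.natAbs} := by
    rw [filter_image, card_image_of_injective _ neg_injective]
    simp
  rw [this]
  have : 0 < -x ↔ ¬ 0 < x := by omega
  rw [this]
  tauto

lemma posAltLabels_neg {n : ℕ} {f : Fin n → ℤ} (h0 : ∀ i, f i ≠ 0) :
    PosAltLabels (fun i => - f i) ↔ NegAltLabels f := by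
  have h : univ.image (fun i => - f i) = (univ.image f).image Neg.neg := by
    rw [image_image]; rfl
  unfold PosAltLabels NegAltLabels
  rw [h, posAlt_image_neg (by simpa using h0), card_image_of_injective _ neg_injective]

/-! ### Flags of sign vectors and Fan's parity lemma -/

/-- The order on sign vectors: `Y` extends `X` if they agree on the support of `X`. -/
def SignLE {ι : Type*} (X Y : ι → SignType) : Prop := ∀ c, X c ≠ 0 → Y c = X c

/-- A permutation `π` of the coordinates and a full sign vector `s` encode a maximal flag
`X₀ > X₁ > … > Xₙ₋₁` of nonzero sign vectors: `Xᵢ` is the restriction of `s` to the coordinates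
`π i, …, π (n - 1)`. -/
def flagVec {n : ℕ} (π : Equiv.Perm (Fin n)) (s : Fin n → SignTypeˣ) (i : Fin n) :
    Fin n → SignType :=
  fun c => if i ≤ π.symm c then (s c : SignType) else 0

lemma flagVec_ne_zero {n : ℕ} (π : Equiv.Perm (Fin n)) (s : Fin n → SignTypeˣ) (i : Fin n) :
    flagVec π s i ≠ 0 := fun h => by
  have := congrFun h (π i)
  simp [flagVec] at this

lemma flagVec_neg {n : ℕ} (π : Equiv.Perm (Fin n)) (s : Fin n → SignTypeˣ) (i : Fin n) :
    flagVec π (-s) i = - flagVec π s i := by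
  ext1 c
  by_cases h : i ≤ π.symm c <;> simp [flagVec, h]

lemma flagVec_signLE {n : ℕ} (π : Equiv.Perm (Fin n)) (s : Fin n → SignTypeˣ) {i j : Fin n}
    (hij : i ≤ j) : SignLE (flagVec π s j) (flagVec π s i) := by
  intro c hc
  have h : j ≤ π.symm c := by
    by_contra h
    simp [flagVec, h] at hc
  simp [flagVec, h, hij.trans h]

lemma label_flagVec_ne_neg {n : ℕ} {lam : (Fin n → SignType) → ℤ}
    (hcompl : ∀ X Y, X ≠ 0 → SignLE X Y → lam X ≠ - lam Y) (π : Equiv.Perm (Fin n))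
    (s : Fin n → SignTypeˣ) (i j : Fin n) : lam (flagVec π s i) ≠ - lam (flagVec π s j) := by
  rcases le_total i j with h | h
  · intro h'
    exact hcompl _ _ (flagVec_ne_zero π s j) (flagVec_signLE π s h) (by rw [h', neg_neg])
  · exact hcompl _ _ (flagVec_ne_zero π s i) (flagVec_signLE π s h)

/-- Two flags that differ by exchanging the coordinates at the positions `i - 1` and `i` agree
except for their `i`-th members. -/
lemma flagVec_mul_swap {n : ℕ} (π : Equiv.Perm (Fin (n + 1))) (s : Fin (n + 1) → SignTypeˣ)
    (i : Fin n) {j : Fin (n + 1)} (hj : j ≠ i.succ) :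
    flagVec (π * Equiv.swap i.castSucc i.succ) s j = flagVec π s j := by
  ext1 c
  have : (π * Equiv.swap i.castSucc i.succ).symm c =
      Equiv.swap i.castSucc i.succ (π.symm c) := by
    rw [Equiv.symm_apply_eq]; simp
  unfold flagVec
  rw [this]
  congr 1
  rw [Equiv.swap_apply_def]
  rw [Ne, Fin.ext_iff] at hj
  simp only [Fin.ext_iff, Fin.le_def] at *
  split_ifs <;> simp_all <;> omega

/-- Two flags that differ by the sign at their first coordinate agree except for their largest
members. -/
lemma flagVec_update_neg {n : ℕ} (π : Equiv.Perm (Fin (n + 1))) (s : Fin (n + 1) → SignTypeˣ)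
    {j : Fin (n + 1)} (hj : j ≠ 0) :
    flagVec π (Function.update s (π 0) (- s (π 0))) j = flagVec π s j := by
  ext1 c
  unfold flagVec
  by_cases hc : c = π 0
  · subst hc
    simp [hj]
  · rw [Function.update_of_ne hc]

/-- A flag that starts with the coordinate `0` is, after its largest member, a flag on the
remaining coordinates. -/
lemma flagVec_decomposeFin {n : ℕ} (π : Equiv.Perm (Fin n)) (e : SignTypeˣ) (s : Fin n → SignTypeˣ)
    (i : Fin n) :
    flagVec (Equiv.Perm.decomposeFin.symm (0, π)) (Fin.cons e s) i.succ =
      Fin.cons 0 (flagVec π s i) := by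
  have h : ∀ c, (Equiv.Perm.decomposeFin.symm (0, π)).symm c =
      (Fin.cons 0 (fun c => (π.symm c).succ) : Fin (n + 1) → Fin (n + 1)) c := by
    intro c
    rw [Equiv.symm_apply_eq]
    cases c using Fin.cases <;> simp
  ext1 c
  unfold flagVec
  rw [h]
  cases c using Fin.cases <;> simp

lemma signTypeUnits_eq (u : SignTypeˣ) : u ≠ 1 ↔ u = -1 := by revert u; decide

open Classical in
/-- Flags with largest member negative at coordinate `0` are the antipodes of those with largest
member positive there. -/
lemma sum_flags_eq_sum_pos {n : ℕ} (F : (Fin (n + 1) → SignTypeˣ) → ZMod 2) :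
    ∑ s, F s = ∑ s with s 0 = 1, (F s + F (-s)) := by
  rw [← sum_filter_add_sum_filter_not univ (fun s => s 0 = 1), sum_add_distrib]
  congr 1
  refine sum_nbij' (fun s => -s) (fun s => -s) ?_ ?_ ?_ ?_ ?_
  · intro s hs
    simp only [mem_filter_univ, signTypeUnits_eq] at hs ⊢
    simp [hs]
  · intro s hs
    simp only [mem_filter_univ, signTypeUnits_eq] at hs ⊢
    simp [hs]
  all_goals simp

open Classical in
/-- **Fan's parity lemma**: for an antipodal labelling of the nonzero sign vectors without
complementary edges, the number of positively alternating maximal flags is odd. -/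
theorem sum_posAltLabels_flags : ∀ (n : ℕ) (lam : (Fin n → SignType) → ℤ)
    (_ : ∀ X, X ≠ 0 → lam (-X) = - lam X)
    (_ : ∀ X Y, X ≠ 0 → SignLE X Y → lam X ≠ - lam Y),
    (∑ π : Equiv.Perm (Fin n), ∑ s : Fin n → SignTypeˣ,
      if PosAltLabels (fun i => lam (flagVec π s i)) then (1 : ZMod 2) else 0) = 1 := by
  intro n
  induction n with
  | zero =>
    intro lam _ _
    simp [PosAltLabels, PosAlt]
  | succ n ih =>
    intro lam hanti hcompl
    have hcompl' := label_flagVec_ne_neg hcompl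
    have hne : ∀ π s (i : Fin (n + 1)), lam (flagVec π s i) ≠ 0 := by
      intro π s i h
      exact hcompl' π s i i (by simp [h])
    -- count the positively alternating facets of the flags in a hemisphere
    have h1 : ∀ π : Equiv.Perm (Fin (n + 1)), (∑ s : Fin (n + 1) → SignTypeˣ,
        if PosAltLabels (fun i => lam (flagVec π s i)) then (1 : ZMod 2) else 0) =
        ∑ s : Fin (n + 1) → SignTypeˣ with s 0 = 1, ∑ i : Fin (n + 1),
          if PosAltLabels ((fun i => lam (flagVec π s i)) ∘ i.succAbove) then 1 else 0 := by
      intro π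
      rw [sum_flags_eq_sum_pos]
      refine sum_congr rfl fun s _ => ?_
      rw [sum_posAltLabels_succAbove _ (hcompl' π s)]
      congr 2
      rw [← posAltLabels_neg (hne π s)]
      simp only [flagVec_neg, hanti _ (flagVec_ne_zero _ _ _)]
    rw [sum_congr rfl fun π _ => h1 π]
    refine Eq.trans ?_ (ih (fun X => lam (Fin.cons 0 X)) ?_ ?_)
    rotate_left
    · intro X hX
      rw [← hanti]
      · congr 1
        ext1 c
        cases c using Fin.cases <;> simp
      · intro h
        apply hX
        ext1 c
        simpa using congrFun h c.succ
    · intro X Y hX hXY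
      apply hcompl
      · intro h
        apply hX
        ext1 c
        simpa using congrFun h c.succ
      · intro c
        cases c using Fin.cases with
        | zero => simp
        | succ c => simpa using hXY c
    simp only [Fin.sum_univ_succ, sum_add_distrib]
    -- a facet that omits an intermediate member is shared by two flags
    have hmid : (∑ π : Equiv.Perm (Fin (n + 1)), ∑ s : Fin (n + 1) → SignTypeˣ with s 0 = 1,
        ∑ i : Fin n, if PosAltLabels ((fun i => lam (flagVec π s i)) ∘ i.succ.succAbove)
          then (1 : ZMod 2) else 0) = 0 := by
      rw [sum_comm]
      refine sum_eq_zero fun s _ => ?_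
      rw [sum_comm]
      refine sum_eq_zero fun i _ => ?_
      have hinv : ∀ π : Equiv.Perm (Fin (n + 1)),
          (fun j => lam (flagVec (π * Equiv.swap i.castSucc i.succ) s j)) ∘ i.succ.succAbove =
          (fun j => lam (flagVec π s j)) ∘ i.succ.succAbove := fun π => by
        ext1 j
        simp only [Function.comp_apply]
        rw [flagVec_mul_swap π s i (Fin.succAbove_ne _ _)]
      refine sum_involution (fun π _ => π * Equiv.swap i.castSucc i.succ) ?_ ?_ ?_ ?_
      · intro π _
        rw [hinv]
        exact CharTwo.add_self_eq_zero _
      · intro π _ _ h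
        simp [Equiv.swap_eq_one_iff, Fin.ext_iff] at h
      · simp
      · simp [mul_assoc]
    -- a facet that omits the largest member and another coordinate than `0` is shared by two flags
    have htop : ∀ π : Equiv.Perm (Fin (n + 1)), π 0 ≠ 0 →
        (∑ s : Fin (n + 1) → SignTypeˣ with s 0 = 1,
          if PosAltLabels ((fun i => lam (flagVec π s i)) ∘ (0 : Fin (n + 1)).succAbove)
            then (1 : ZMod 2) else 0) = 0 := by
      intro π hπ
      have hinv : ∀ s : Fin (n + 1) → SignTypeˣ,
          (fun j => lam (flagVec π (Function.update s (π 0) (- s (π 0))) j)) ∘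
            (0 : Fin (n + 1)).succAbove =
          (fun j => lam (flagVec π s j)) ∘ (0 : Fin (n + 1)).succAbove := fun s => by
        ext1 j
        simp only [Function.comp_apply]
        rw [flagVec_update_neg π s (Fin.succAbove_ne _ _)]
      refine sum_involution (fun s _ => Function.update s (π 0) (- s (π 0))) ?_ ?_ ?_ ?_
      · intro s _
        rw [hinv]
        exact CharTwo.add_self_eq_zero _
      · intro s _ _ h
        have := congrFun h (π 0)
        rw [Function.update_self] at this
        revert this
        generalize s (π 0) = u
        revert u
        decide
      · intro s hs
        rw [mem_filter_univ] at hs ⊢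
        rw [Function.update_of_ne hπ.symm, hs]
      · simp
    rw [hmid, add_zero, ← Equiv.sum_comp Equiv.Perm.decomposeFin.symm, Fintype.sum_prod_type,
      Fin.sum_univ_succ, sum_eq_zero (s := univ) (f := fun i : Fin n => ∑ y, _), add_zero]
    · refine sum_congr rfl fun π _ => ?_
      refine sum_nbij' (fun s => Fin.tail s) (fun s => Fin.cons 1 s) ?_ ?_ ?_ ?_ ?_
      · simp
      · simp
      · intro s hs
        rw [mem_filter_univ] at hs
        rw [← hs]
        exact Fin.cons_self_tail s
      · simp
      · intro s hs
        rw [mem_filter_univ] at hs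
        have : s = Fin.cons 1 (Fin.tail s) := by rw [← hs]; exact (Fin.cons_self_tail s).symm
        rw [this]
        congr 2
        ext1 i
        simp [flagVec_decomposeFin]
    · intro i _
      refine sum_eq_zero fun π _ => htop _ ?_
      simp

/-- **The octahedral Tucker lemma**: an antipodal labelling of the nonzero sign vectors of length
`n` without complementary edges needs at least `n` absolute values of labels. -/
theorem octahedral_tucker {n m : ℕ} (lam : (Fin n → SignType) → ℤ)
    (hanti : ∀ X, X ≠ 0 → lam (-X) = - lam X)
    (hcompl : ∀ X Y, X ≠ 0 → SignLE X Y → lam X ≠ - lam Y)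
    (hbound : ∀ X, X ≠ 0 → (lam X).natAbs ≤ m) : n ≤ m := by
  classical
  have hsum := sum_posAltLabels_flags n lam hanti hcompl
  obtain ⟨π, -, hπ⟩ := exists_ne_zero_of_sum_ne_zero (hsum ▸ one_ne_zero)
  obtain ⟨s, -, hs⟩ := exists_ne_zero_of_sum_ne_zero hπ
  have hinj : Function.Injective fun i => lam (flagVec π s i) := by
    have h : PosAltLabels fun i => lam (flagVec π s i) := by
      by_contra h
      simp [h] at hs
    have h1 : #(univ.image fun i => lam (flagVec π s i)) = #(univ : Finset (Fin n)) :=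
      h.1.trans (by simp)
    simpa using card_image_iff.1 h1
  have hlt := label_flagVec_ne_neg hcompl π s
  have := card_le_card_of_injOn (s := (univ : Finset (Fin n))) (t := Icc 1 m)
    (fun i => (lam (flagVec π s i)).natAbs) ?_ ?_
  · simpa using this
  · intro i _
    have h1 := hlt i i
    have h2 := hbound _ (flagVec_ne_zero π s i)
    simp only [coe_Icc, Set.mem_Icc]
    omega
  · intro i _ j _ hij
    rcases Int.natAbs_eq_natAbs_iff.1 hij with h | h
    · exact hinj h
    · exact absurd h (hlt i j)

/-! ### Alternating subsequences of sign vectors and the colouring bound -/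

/-- The restriction of `X` to `T` alternates in sign, beginning with the sign `u`. -/
def AltOn {n : ℕ} (u : SignType) (T : Finset (Fin n)) (X : Fin n → SignType) : Prop :=
  ∀ i ∈ T, X i = if Even #{j ∈ T | j < i} then u else -u

open Classical in
/-- The length of a longest alternating subsequence of `X` that begins with the sign `u`. -/
noncomputable def altNum {n : ℕ} (u : SignType) (X : Fin n → SignType) : ℕ :=
  ({T | AltOn u T X} : Finset (Finset (Fin n))).sup card

lemma AltOn.card_le_altNum {n : ℕ} {u : SignType} {T : Finset (Fin n)} {X : Fin n → SignType}
    (h : AltOn u T X) : #T ≤ altNum u X :=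
  le_sup (f := card) (by simpa using h)

lemma exists_altOn_card_eq_altNum {n : ℕ} (u : SignType) (X : Fin n → SignType) :
    ∃ T, AltOn u T X ∧ #T = altNum u X := by
  classical
  obtain ⟨T, hT, h⟩ := exists_mem_eq_sup ({T | AltOn u T X} : Finset (Finset (Fin n)))
    ⟨∅, mem_filter.2 ⟨mem_univ _, fun i hi => absurd hi (notMem_empty i)⟩⟩ card
  exact ⟨T, by simpa using hT, h.symm⟩

lemma AltOn.mono {n : ℕ} {u : SignType} (hu : u ≠ 0) {T : Finset (Fin n)}
    {X Y : Fin n → SignType} (h : AltOn u T X) (hXY : SignLE X Y) : AltOn u T Y := fun i hi => by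
  have := h i hi
  rw [hXY i, this]
  rw [this]
  split_ifs <;> simpa

lemma altNum_mono {n : ℕ} {u : SignType} (hu : u ≠ 0) {X Y : Fin n → SignType}
    (hXY : SignLE X Y) : altNum u X ≤ altNum u Y := by
  obtain ⟨T, hT, h⟩ := exists_altOn_card_eq_altNum u X
  exact h ▸ (hT.mono hu hXY).card_le_altNum

lemma altOn_neg {n : ℕ} {u : SignType} {T : Finset (Fin n)} {X : Fin n → SignType} :
    AltOn u T (-X) ↔ AltOn (-u) T X := by
  refine forall₂_congr fun i _ => ?_
  rw [Pi.neg_apply, neg_eq_iff_eq_neg]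
  split_ifs <;> rfl

lemma altNum_neg {n : ℕ} (u : SignType) (X : Fin n → SignType) :
    altNum u (-X) = altNum (-u) X := by
  unfold altNum
  congr 1
  ext T
  simp only [mem_filter_univ, altOn_neg]

/-- Prepending the first nonzero entry of `X` to an alternating subsequence. -/
lemma altNum_neg_lt_of_first {n : ℕ} {u : SignType} (hu : u ≠ 0) {X : Fin n → SignType}
    {i₀ : Fin n} (h₀ : X i₀ = u) (hmin : ∀ j < i₀, X j = 0) : altNum (-u) X < altNum u X := by
  obtain ⟨T, hT, h⟩ := exists_altOn_card_eq_altNum (-u) X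
  have hne : ∀ i ∈ T, X i ≠ 0 := fun i hi => by
    rw [hT i hi]
    split_ifs <;> simpa
  have hge : ∀ i ∈ T, i₀ ≤ i := fun i hi => by
    by_contra hlt
    exact hne i hi (hmin i (not_le.1 hlt))
  have hmem : i₀ ∉ T := fun hi => by
    have := hT i₀ hi
    rw [filter_false_of_mem fun j hj => not_lt.2 (hge j hj), h₀, card_empty, if_pos Even.zero]
      at this
    exact (show ∀ u : SignType, u ≠ 0 → u ≠ -u by decide) u hu this
  have hT' : AltOn u (insert i₀ T) X := by
    intro i hi
    rw [mem_insert] at hi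
    rcases hi with rfl | hi
    · rw [filter_false_of_mem, h₀]
      · simp
      · simp only [mem_insert, forall_eq_or_imp, not_lt]
        exact ⟨le_rfl, hge⟩
    · have hlt : i₀ < i := lt_of_le_of_ne (hge i hi) fun h => hmem (h ▸ hi)
      rw [filter_insert, if_pos hlt, card_insert_of_notMem (by simp [hmem]), hT i hi]
      simp only [Nat.even_add_one]
      split_ifs <;> simp
  have := hT'.card_le_altNum
  rw [card_insert_of_notMem hmem] at this
  omega

lemma altNum_one_ne_altNum_neg_one {n : ℕ} {X : Fin n → SignType} (hX : X ≠ 0) :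
    altNum 1 X ≠ altNum (-1) X := by
  classical
  have hex : (univ.filter fun i => X i ≠ 0).Nonempty := by
    obtain ⟨i, hi⟩ := Function.ne_iff.1 hX
    exact ⟨i, by simpa using hi⟩
  set i₀ := (univ.filter fun i => X i ≠ 0).min' hex
  have h₀ : X i₀ ≠ 0 := by simpa using min'_mem _ hex
  have hmin : ∀ j < i₀, X j = 0 := fun j hj => by
    by_contra h
    exact absurd (min'_le (univ.filter fun i => X i ≠ 0) j (by simpa using h)) (not_le.2 hj)
  rcases h : X i₀ with _ | _ | _
  · exact absurd h h₀
  · have := altNum_neg_lt_of_first (u := -1) (by decide) h hmin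
    rw [neg_neg] at this
    exact this.ne
  · exact (altNum_neg_lt_of_first (u := 1) (by decide) h hmin).ne'

lemma AltOn.exists_subset_card_eq {n : ℕ} {u : SignType} {X : Fin n → SignType} {m : ℕ}
    {T : Finset (Fin n)} (hT : AltOn u T X) (hm : m ≤ #T) : ∃ T', AltOn u T' X ∧ #T' = m := by
  induction T using Finset.induction_on_max with
  | empty => exact ⟨∅, hT, by rw [card_empty] at hm ⊢; omega⟩
  | insert a T hlt ih =>
    have ha : a ∉ T := fun h => lt_irrefl _ (hlt a h)
    rcases eq_or_lt_of_le hm with rfl | hm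
    · exact ⟨_, hT, rfl⟩
    · rw [card_insert_of_notMem ha] at hm
      refine ih (fun i hi => ?_) (by omega)
      rw [hT i (mem_insert_of_mem hi), filter_insert, if_neg (hlt i hi).le.not_gt]

/-- The larger of two natural numbers, negated if it is the second one. -/
def signedMax (p q : ℕ) : ℤ := if q < p then p else -q

lemma signedMax_swap {p q : ℕ} (h : p ≠ q) : signedMax q p = - signedMax p q := by
  unfold signedMax; split_ifs <;> omega

lemma natAbs_signedMax_le {p q m : ℕ} (hp : p ≤ m) (hq : q ≤ m) : (signedMax p q).natAbs ≤ m := by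
  unfold signedMax; split_ifs <;> omega

lemma signedMax_ne_neg {p q p' q' : ℕ} (hp : p ≤ p') (hq : q ≤ q') (h' : p' ≠ q') :
    signedMax p q ≠ - signedMax p' q' := by
  unfold signedMax; split_ifs <;> omega

section Colouring

variable {n c : ℕ} {α : Type*} (supp : α → Finset (Fin n)) (col : α → Fin c)

open Classical in
/-- The largest colour, counted from one, of a set `supp a` on which `X` has the constant value
`u`, and zero if there is none. -/
noncomputable def topColour (u : SignType) (X : Fin n → SignType) : ℕ :=
  ({k | ∃ a, col a = k ∧ ∀ i ∈ supp a, X i = u} : Finset (Fin c)).sup fun k => k + 1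

variable {supp col}

lemma lt_topColour {u : SignType} {X : Fin n → SignType} {a : α} (ha : ∀ i ∈ supp a, X i = u) :
    (col a : ℕ) + 1 ≤ topColour supp col u X :=
  le_sup (f := fun k : Fin c => (k : ℕ) + 1) (by simpa using ⟨a, rfl, ha⟩)

lemma topColour_le (u : SignType) (X : Fin n → SignType) : topColour supp col u X ≤ c :=
  Finset.sup_le fun k _ => k.2

lemma exists_col_eq_topColour {u : SignType} {X : Fin n → SignType}
    (h : 0 < topColour supp col u X) :
    ∃ a, (∀ i ∈ supp a, X i = u) ∧ (col a : ℕ) + 1 = topColour supp col u X := by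
  classical
  unfold topColour at h ⊢
  rcases ({k | ∃ a, col a = k ∧ ∀ i ∈ supp a, X i = u} : Finset (Fin c)).eq_empty_or_nonempty
    with h0 | h0
  · simp [h0] at h
  · obtain ⟨k, hk, h⟩ := exists_mem_eq_sup _ h0 fun k : Fin c => (k : ℕ) + 1
    rw [mem_filter_univ] at hk
    obtain ⟨a, rfl, ha⟩ := hk
    exact ⟨a, ha, h.symm⟩

lemma topColour_mono {u : SignType} (hu : u ≠ 0) {X Y : Fin n → SignType} (hXY : SignLE X Y) :
    topColour supp col u X ≤ topColour supp col u Y := by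
  rcases Nat.eq_zero_or_pos (topColour supp col u X) with h | h
  · omega
  · obtain ⟨a, ha, h⟩ := exists_col_eq_topColour h
    rw [← h]
    exact lt_topColour fun i hi => by rw [hXY i (by rw [ha i hi]; exact hu), ha i hi]

lemma topColour_neg (u : SignType) (X : Fin n → SignType) :
    topColour supp col u (-X) = topColour supp col (-u) X := by
  unfold topColour
  congr 1
  ext k
  simp only [mem_filter_univ, Pi.neg_apply, neg_eq_iff_eq_neg]

variable (supp col) in
/-- The labels used with Tucker's lemma, for each of the two signs: the alternation number as long
as it is at most `s` for both signs, and the shifted largest colour afterwards. -/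
noncomputable def signedLabel (s : ℕ) (u : SignType) (X : Fin n → SignType) : ℕ :=
  if max (altNum 1 X) (altNum (-1) X) ≤ s then altNum u X else s + (topColour supp col u X - 1)

lemma signedLabel_mono {s : ℕ} {u : SignType} (hu : u = 1 ∨ u = -1) {X Y : Fin n → SignType}
    (hXY : SignLE X Y) : signedLabel supp col s u X ≤ signedLabel supp col s u Y := by
  have hu0 : u ≠ 0 := by rcases hu with rfl | rfl <;> decide
  have h1 := altNum_mono (u := 1) (by decide) hXY
  have h2 := altNum_mono (u := -1) (by decide) hXY
  have h3 := altNum_mono hu0 hXY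
  have h4 := topColour_mono (supp := supp) (col := col) hu0 hXY
  have h5 : altNum u X ≤ max (altNum 1 X) (altNum (-1) X) := by rcases hu with rfl | rfl <;> simp
  unfold signedLabel
  split_ifs <;> omega

lemma signedLabel_neg (s : ℕ) (u : SignType) (X : Fin n → SignType) :
    signedLabel supp col s u (-X) = signedLabel supp col s (-u) X := by
  unfold signedLabel
  rw [altNum_neg, altNum_neg, altNum_neg, topColour_neg, neg_neg, max_comm]

/-- Assume that every set of `s + 1` positions, split alternately into two classes, has a member
of a set family within each class, and that disjoint members of the family have distinct colours.
Tucker's lemma bounds the number `n` of positions by the number of labels. As the two classes have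
members of different colours, the larger of their top colours is at least two, so that only `c - 1`
labels are needed beyond the alternation numbers up to `s`. -/
theorem card_le_of_alternating (s : ℕ)
    (hcol : ∀ a b, Disjoint (supp a) (supp b) → col a ≠ col b)
    (heven : ∀ T : Finset (Fin n), #T = s + 1 → ∃ a, supp a ⊆ {i ∈ T | Even #{j ∈ T | j < i}})
    (hodd : ∀ T : Finset (Fin n), #T = s + 1 → ∃ a, supp a ⊆ {i ∈ T | ¬ Even #{j ∈ T | j < i}}) :
    n ≤ s + (c - 1) := by
  have hpos : ∀ X : Fin n → SignType, ∀ u, s < altNum u X →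
      0 < topColour supp col u X ∧ 0 < topColour supp col (-u) X := by
    intro X u h
    obtain ⟨T, hT, hcard⟩ := exists_altOn_card_eq_altNum u X
    obtain ⟨T, hT, hcard⟩ := hT.exists_subset_card_eq (m := s + 1) (by omega)
    obtain ⟨a, ha⟩ := heven T hcard
    obtain ⟨b, hb⟩ := hodd T hcard
    constructor
    · refine lt_of_lt_of_le (Nat.succ_pos _) (lt_topColour (a := a) fun i hi => ?_)
      have := mem_filter.1 (ha hi)
      rw [hT i this.1, if_pos this.2]
    · refine lt_of_lt_of_le (Nat.succ_pos _) (lt_topColour (a := b) fun i hi => ?_)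
      have := mem_filter.1 (hb hi)
      rw [hT i this.1, if_neg this.2]
  have hne : ∀ X : Fin n → SignType, X ≠ 0 →
      signedLabel supp col s 1 X ≠ signedLabel supp col s (-1) X := by
    intro X hX
    unfold signedLabel
    split_ifs with h
    · exact altNum_one_ne_altNum_neg_one hX
    · have hp : 0 < topColour supp col 1 X ∧ 0 < topColour supp col (-1) X := by
        rcases lt_max_iff.1 (not_le.1 h) with h | h
        · exact hpos X 1 h
        · simpa [and_comm] using hpos X (-1) h
      intro heq
      obtain ⟨a, ha, hca⟩ := exists_col_eq_topColour hp.1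
      obtain ⟨b, hb, hcb⟩ := exists_col_eq_topColour hp.2
      refine hcol a b ?_ (Fin.ext (by omega))
      rw [disjoint_left]
      intro i hi hi'
      have := (ha i hi).symm.trans (hb i hi')
      revert this
      decide
  refine octahedral_tucker
    (fun X => signedMax (signedLabel supp col s 1 X) (signedLabel supp col s (-1) X)) ?_ ?_ ?_
  · intro X hX
    simp only [signedLabel_neg, neg_neg]
    exact signedMax_swap (hne X hX)
  · intro X Y hX hXY
    refine signedMax_ne_neg (signedLabel_mono (Or.inl rfl) hXY) (signedLabel_mono (Or.inr rfl) hXY)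
      (hne Y fun hY => hX ?_)
    ext1 i
    by_contra h
    have := hXY i h
    rw [hY] at this
    exact h this.symm
  · have hle : ∀ X u, u = 1 ∨ u = -1 → signedLabel supp col s u X ≤ s + (c - 1) := by
      intro X u hu
      have h5 : altNum u X ≤ max (altNum 1 X) (altNum (-1) X) := by
        rcases hu with rfl | rfl <;> simp
      have := topColour_le (supp := supp) (col := col) u X
      unfold signedLabel
      split_ifs <;> omega
    exact fun X _ => natAbs_signedMax_le (hle X 1 (Or.inl rfl)) (hle X (-1) (Or.inr rfl))

end Colouring

/-! ### Odd cycles -/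

namespace SimpleGraph

variable {V : Type*} {G : SimpleGraph V}

/-- A shortest odd closed walk is a cycle. -/
lemma Walk.exists_isCycle_of_odd_length {v : V} (c : G.Walk v v) (hc : Odd c.length) :
    ∃ (w : V) (c' : G.Walk w w), c'.IsCycle ∧ Odd c'.length := by
  induction h : c.length using Nat.strong_induction_on generalizing v c with
  | _ n ih =>
    subst h
    by_cases hcyc : c.IsCycle
    · exact ⟨v, c, hcyc, hc⟩
    cases c with
    | nil => simp at hc
    | @cons _ x _ hadj p =>
      have hlen : 3 ≤ (Walk.cons hadj p).length := by
        cases p with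
        | nil => exact absurd rfl hadj.ne
        | cons h' q =>
          cases q with
          | nil => simp [Nat.odd_iff] at hc
          | cons _ _ => simp
      have hpath : ¬ p.IsPath := fun hp =>
        hcyc (Walk.isCycle_iff_isPath_tail_and_le_length.2 ⟨by simpa using hp, hlen⟩)
      rw [Walk.isPath_iff_isSubwalk_imp_nil] at hpath
      push Not at hpath
      obtain ⟨w, q, ⟨a, b, rfl⟩, hq⟩ := hpath
      have hq : q.length ≠ 0 := fun h => hq (Walk.length_eq_zero_iff.1 h)
      rcases Nat.even_or_odd q.length with hev | hodd
      · refine ih (Walk.cons hadj (a.append b)).length ?_ _ ?_ rfl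
        · simp only [Walk.length_cons, Walk.length_append]
          omega
        · simp only [Walk.length_cons, Walk.length_append] at hc ⊢
          rw [Nat.odd_iff] at hc ⊢
          rw [Nat.even_iff] at hev
          omega
      · refine ih q.length ?_ q hodd rfl
        simp only [Walk.length_cons, Walk.length_append]
        omega

lemma exists_isCycle_odd_of_not_isBipartite (h : ¬ G.IsBipartite) :
    ∃ (v : V) (c : G.Walk v v), c.IsCycle ∧ Odd c.length := by
  by_contra hno
  have heven : ∀ (v : V) (c : G.Walk v v), Even c.length := fun v c => by
    by_contra hc
    exact hno (c.exists_isCycle_of_odd_length (Nat.not_even_iff_odd.1 hc))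
  refine h ?_
  -- colour each vertex by the parity of a walk from a representative of its component
  have hreach : ∀ v, G.Reachable (G.connectedComponentMk v).out v := fun v =>
    ConnectedComponent.exact (G.connectedComponentMk v).out_eq
  have hp : ∀ v, G.Walk (G.connectedComponentMk v).out v := fun v => (hreach v).some
  refine ⟨Coloring.mk (fun v => if Even (hp v).length then (0 : Fin 2) else 1) ?_⟩
  intro v w hadj heq
  have hrep : (G.connectedComponentMk v).out = (G.connectedComponentMk w).out := by
    rw [ConnectedComponent.sound hadj.reachable]
  have := heven _ (((hp v).concat hadj).append ((hp w).reverse.copy rfl hrep.symm))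
  simp only [Walk.length_append, Walk.length_concat, Walk.length_copy, Walk.length_reverse] at this
  split_ifs at heq with h1 h2 h2 <;> simp at heq <;> grind

/-! ### Eulerian circuits -/

/-- **Euler's theorem**: a finite connected graph with all degrees even has an Eulerian circuit. -/
theorem Connected.exists_isEulerian_circuit [Fintype V] [DecidableEq V] [DecidableRel G.Adj]
    (hG : G.Connected) (heven : ∀ v, Even (G.degree v)) :
    ∃ (v : V) (p : G.Walk v v), p.IsEulerian := by
  classical
  -- a trail of maximal length
  obtain ⟨u, v, p, hp, hmax⟩ : ∃ (u v : V) (p : G.Walk u v), p.IsTrail ∧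
      ∀ (u' v' : V) (p' : G.Walk u' v'), p'.IsTrail → p'.length ≤ p.length := by
    have hfin : ∃ m, ∃ (u v : V) (p : G.Walk u v), p.IsTrail ∧ p.length = m :=
      ⟨0, hG.nonempty.some, _, Walk.nil, by simp, rfl⟩
    have hbdd : ∀ m, (∃ (u v : V) (p : G.Walk u v), p.IsTrail ∧ p.length = m) →
        m ≤ #G.edgeFinset := by
      rintro m ⟨u, v, p, hp, rfl⟩
      exact hp.length_le_card_edgeFinset
    obtain ⟨u, v, p, hp, hlen⟩ := Nat.findGreatest_spec
      (P := fun m => ∃ (u v : V) (p : G.Walk u v), p.IsTrail ∧ p.length = m)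
      (hbdd _ hfin.choose_spec) hfin.choose_spec
    refine ⟨u, v, p, hp, fun u' v' p' hp' => ?_⟩
    rw [hlen]
    exact Nat.le_findGreatest (hbdd _ ⟨u', v', p', hp', rfl⟩) ⟨u', v', p', hp', rfl⟩
  have huv : u = v := by
    by_contra hne
    have hodd : ¬ Even (p.edges.countP fun e => v ∈ e) := by
      rw [hp.even_countP_edges_iff v]
      exact fun h => (h hne).2 rfl
    have hsub : (p.edges.filter fun e => v ∈ e).toFinset ⊆ G.incidenceFinset v := by
      intro e he
      simp only [List.mem_toFinset, List.mem_filter, decide_eq_true_eq] at he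
      rw [mem_incidenceFinset]
      exact ⟨p.edges_subset_edgeSet he.1, he.2⟩
    have hcard : #(p.edges.filter fun e => v ∈ e).toFinset = p.edges.countP fun e => v ∈ e := by
      rw [List.toFinset_card_of_nodup (hp.edges_nodup.filter _), List.countP_eq_length_filter]
    have hneq : (p.edges.filter fun e => v ∈ e).toFinset ≠ G.incidenceFinset v := fun h => by
      rw [h, card_incidenceFinset_eq_degree] at hcard
      exact hodd (hcard ▸ heven v)
    obtain ⟨e, he, hep⟩ := exists_of_ssubset (hsub.ssubset_of_ne hneq)
    rw [mem_incidenceFinset] at he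
    obtain ⟨w, rfl⟩ := Sym2.mem_iff_exists.1 he.2
    have hadj : G.Adj v w := he.1
    simp only [List.mem_toFinset, List.mem_filter, decide_eq_true_eq, Sym2.mem_mk_left,
      and_true] at hep
    have := hmax _ _ (Walk.cons hadj.symm p.reverse) (by
      rw [Walk.isTrail_cons]
      exact ⟨hp.reverse, by rwa [Walk.edges_reverse, List.mem_reverse, Sym2.eq_swap]⟩)
    simp at this
  subst huv
  refine ⟨u, p, hp.isEulerian_of_forall_mem fun e he => ?_⟩
  by_contra hep
  obtain ⟨x, y, hx, hadj, hxy⟩ : ∃ x y, x ∈ p.support ∧ G.Adj x y ∧ s(x, y) ∉ p.edges := by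
    induction e with
    | _ a b =>
      by_cases ha : a ∈ p.support
      · exact ⟨a, b, ha, he, hep⟩
      · obtain ⟨q⟩ := hG.preconnected u a
        obtain ⟨d, -, hd, hd'⟩ := q.exists_boundary_dart {x | x ∈ p.support} (by simp) ha
        exact ⟨d.fst, d.snd, hd, d.adj, fun h => hd' (p.snd_mem_support_of_mem_edges h)⟩
  have := hmax _ _ (Walk.cons hadj.symm (p.rotate x hx)) (by
    rw [Walk.isTrail_cons]
    refine ⟨hp.rotate hx, ?_⟩
    rwa [(p.rotate_edges x hx).mem_iff, Sym2.eq_swap])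
  have hlen := (p.rotate_edges x hx).perm.length_eq
  simp only [Walk.length_edges] at hlen
  rw [Walk.length_cons] at this
  omega

/-! ### Matchings in bipartite graphs of bounded degree -/

lemma copiesK2_isContained_of_injective {r : ℕ} (f : Fin r × Bool → V) (hf : Function.Injective f)
    (hadj : ∀ i, G.Adj (f (i, false)) (f (i, true))) : copiesK2 r ⊑ G := by
  refine ⟨⟨⟨f, ?_⟩, hf⟩⟩
  rintro ⟨i, a⟩ ⟨j, b⟩ ⟨h1, h2⟩
  obtain rfl : i = j := h1
  cases a <;> cases b
  · exact absurd rfl h2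
  · exact hadj i
  · exact (hadj i).symm
  · exact absurd rfl h2

/-- A bipartite graph with maximum degree at most `D` and more than `D (r - 1)` edges has a matching
with `r` edges: this is the version of Hall's marriage theorem with a deficiency. -/
theorem IsBipartite.copiesK2_isContained [Fintype V] [DecidableRel G.Adj] (hG : G.IsBipartite)
    {D r : ℕ} (hD : ∀ v, G.degree v ≤ D) (hr : 0 < r) (hE : D * (r - 1) < #G.edgeFinset) :
    copiesK2 r ⊑ G := by
  classical
  obtain ⟨s, t, hst⟩ := hG.exists_isBipartiteWith
  lift s to Finset V using s.toFinite
  lift t to Finset V using t.toFinite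
  have hsum := isBipartiteWith_sum_degrees_eq_card_edges hst
  have hkey : ∀ S ⊆ s, r ≤ #(S.biUnion fun a => G.neighborFinset a) + #(s \ S) := by
    intro S hS
    have h1 : ∑ a ∈ S, G.degree a ≤ #(S.biUnion fun a => G.neighborFinset a) * D := by
      set N := S.biUnion fun a => G.neighborFinset a with hN
      calc ∑ a ∈ S, G.degree a = ∑ a ∈ S, #(N.bipartiteAbove G.Adj a) := by
            refine sum_congr rfl fun a ha => ?_
            rw [← card_neighborFinset_eq_degree]
            congr 1
            ext b
            simp only [mem_neighborFinset, mem_bipartiteAbove, hN, mem_biUnion]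
            exact ⟨fun h => ⟨⟨a, ha, h⟩, h⟩, fun h => h.2⟩
        _ = ∑ b ∈ N, #(S.bipartiteBelow G.Adj b) :=
            sum_card_bipartiteAbove_eq_sum_card_bipartiteBelow _
        _ ≤ #N * D := by
            refine sum_le_card_nsmul _ _ _ fun b _ => (card_le_card fun a ha => ?_).trans (hD b)
            rw [mem_bipartiteBelow] at ha
            simpa using ha.2.symm
    have h2 : ∑ a ∈ s \ S, G.degree a ≤ #(s \ S) * D :=
      sum_le_card_nsmul _ _ _ fun b _ => hD b
    rw [← sum_sdiff hS] at hsum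
    have h3 : D * (r - 1) < D * (#(S.biUnion fun a => G.neighborFinset a) + #(s \ S)) := by
      rw [mul_add, mul_comm D #_, mul_comm D #_]
      omega
    have := Nat.lt_of_mul_lt_mul_left h3
    omega
  have hs : r ≤ #s := by simpa using hkey ∅ (empty_subset _)
  -- Hall's theorem, with `#s - r` further elements that are adjacent to all of `s`
  obtain ⟨g, hg, hgmem⟩ := (all_card_le_biUnion_card_iff_exists_injective
    (fun a : s => (G.neighborFinset a).disjSum (univ : Finset (Fin (#s - r))))).1 (by
      intro S
      rcases S.eq_empty_or_nonempty with rfl | ⟨a₀, ha₀⟩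
      · simp
      have h1 := hkey (S.map ⟨_, Subtype.val_injective⟩) (by
        intro x hx
        obtain ⟨y, -, rfl⟩ := mem_map.1 hx
        exact y.2)
      have h2 : S.biUnion (fun a : s => (G.neighborFinset a).disjSum univ) =
          ((S.map ⟨_, Subtype.val_injective⟩).biUnion fun a => G.neighborFinset a).disjSum
            (univ : Finset (Fin (#s - r))) := by
        ext x
        rcases x with x | x
        · simp
        · simpa using ⟨_, _, ha₀⟩
      rw [h2, card_disjSum, card_univ, Fintype.card_fin]
      rw [card_sdiff_of_subset (by
        intro x hx
        obtain ⟨y, -, rfl⟩ := mem_map.1 hx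
        exact y.2), card_map] at h1
      have h3 : #S ≤ #s := (card_le_univ S).trans_eq (Fintype.card_coe s)
      omega)
  have hM : r ≤ #(univ.filter fun a : s => (g a).isLeft) := by
    have h1 : #(univ.filter fun a : s => ¬ (g a).isLeft) ≤ #s - r := by
      have := card_le_card_of_injOn (s := univ.filter fun a : s => ¬ (g a).isLeft)
        (t := (univ : Finset (Fin (#s - r))).map Function.Embedding.inr) g ?_ hg.injOn
      · simpa using this
      · intro a ha
        simp only [coe_filter, Set.mem_ofPred_eq, mem_univ, true_and] at ha
        cases h : g a with
        | inl x => simp [h] at ha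
        | inr x => simp
    have h2 := card_filter_add_card_filter_not (s := (univ : Finset s)) (fun a => (g a).isLeft)
    rw [card_univ, Fintype.card_coe] at h2
    omega
  obtain ⟨M, hM, hMr⟩ := exists_subset_card_eq hM
  have hleft : ∀ i : Fin r, ∃ b, g (M.equivFinOfCardEq hMr |>.symm i) = Sum.inl b := fun i => by
    have := hM ((M.equivFinOfCardEq hMr).symm i).2
    rw [mem_filter] at this
    exact Sum.isLeft_iff.1 this.2
  choose b hb using hleft
  set a : Fin r → s := fun i => ((M.equivFinOfCardEq hMr).symm i : s) with ha
  have hadj : ∀ i, G.Adj (a i) (b i) := fun i => by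
    have := hgmem (a i)
    rw [ha, hb i] at this
    simpa using this
  have hbt : ∀ i, b i ∈ t := fun i => hst.mem_of_mem_adj (a i).2 (hadj i)
  have hdisj : ∀ i j, (a i : V) ≠ b j := fun i j h =>
    Set.disjoint_left.1 hst.disjoint (a i).2 (h ▸ hbt j)
  refine copiesK2_isContained_of_injective (fun x => if x.2 then b x.1 else a x.1) ?_
    (by simpa using hadj)
  have ha_inj : Function.Injective a := fun i j h => by simpa [ha, Subtype.ext_iff] using h
  rintro ⟨i, _ | _⟩ ⟨j, _ | _⟩ h
  · simpa [Subtype.val_inj, ha_inj.eq_iff] using h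
  · exact absurd h (hdisj i j)
  · exact absurd h.symm (hdisj j i)
  · have hij : b i = b j := h
    have := ha_inj (hg ((hb i).trans ((congrArg Sum.inl hij).trans (hb j).symm)))
    rw [this]

end SimpleGraph

/-! ### Odd girth and matchings on cycles -/

namespace SimpleGraph

variable {V : Type*} {G : SimpleGraph V}

lemma oddGirth_le_length {v : V} {c : G.Walk v v} (hc : c.IsCycle) (hodd : Odd c.length) :
    G.oddGirth ≤ c.length :=
  iInf_le_of_le v (iInf_le_of_le c (iInf_le_of_le hc (iInf_le _ hodd)))

/-- Every other edge of a cycle of length at least `2 r` belongs to a matching. -/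
lemma Walk.IsCycle.copiesK2_isContained {v : V} {c : G.Walk v v} (hc : c.IsCycle) {r : ℕ}
    (hr : 2 * r ≤ c.length) : copiesK2 r ⊑ G := by
  refine copiesK2_isContained_of_injective
    (fun x => c.getVert (2 * x.1 + if x.2 then 1 else 0)) ?_ ?_
  · rintro ⟨i, a⟩ ⟨j, b⟩ h
    have hi := i.2
    have hj := j.2
    have h := hc.getVert_injOn' (by cases a <;> simp <;> omega) (by cases b <;> simp <;> omega) h
    cases a <;> cases b <;> simp at h <;> simp [Fin.ext_iff] <;> omega
  · intro i
    have hi := i.2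
    exact c.adj_getVert_succ (i := 2 * i) (by omega)

/-! ### Edge orderings along an Eulerian circuit -/

lemma _root_.val_finRotate {n : ℕ} (i : Fin n) :
    (finRotate n i : ℕ) = if (i : ℕ) + 1 = n then 0 else (i : ℕ) + 1 := by
  cases n with
  | zero => exact i.elim0
  | succ n =>
    rw [finRotate_apply, Fin.val_add_one]
    simp [Fin.ext_iff]

/-- A cyclic sequence of vertices such that the pairs of consecutive vertices run through the edges
of `G`, each edge occurring once: an Eulerian circuit. -/
structure IsCyclicEdgeOrder (G : SimpleGraph V) {n : ℕ} (v : Fin n → V) : Prop where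
  adj : ∀ i, G.Adj (v i) (v (finRotate n i))
  injective : Function.Injective fun i => s(v i, v (finRotate n i))
  surjective : ∀ e ∈ G.edgeSet, ∃ i, s(v i, v (finRotate n i)) = e

lemma Walk.IsEulerian.isCyclicEdgeOrder [DecidableEq V] {u : V} {p : G.Walk u u}
    (hp : p.IsEulerian) : G.IsCyclicEdgeOrder fun i : Fin p.length => p.getVert i := by
  have hnext : ∀ i : Fin p.length, p.getVert (finRotate _ i) = p.getVert (i + 1) := fun i => by
    rw [val_finRotate]
    split_ifs with h
    · rw [h, p.getVert_zero, p.getVert_length]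
    · rfl
  have hedge : ∀ i : Fin p.length, s(p.getVert i, p.getVert (finRotate _ i)) =
      p.edges[(i : ℕ)]'(by simp) := fun i => by
    rw [hnext, Walk.getElem_edges]
  refine ⟨fun i => ?_, fun i j h => ?_, fun e he => ?_⟩
  · rw [hnext]
    exact p.adj_getVert_succ i.2
  · simp only [hedge] at h
    exact Fin.ext ((hp.isTrail.edges_nodup.getElem_inj_iff).1 h)
  · obtain ⟨i, hi, h⟩ := List.getElem_of_mem (hp.mem_edges_iff.2 he)
    exact ⟨⟨i, by simpa using hi⟩, (hedge _).trans h⟩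

namespace IsCyclicEdgeOrder

variable {n : ℕ} {v : Fin n → V}

lemma card_edgeFinset [Fintype G.edgeSet] (hv : G.IsCyclicEdgeOrder v) : #G.edgeFinset = n := by
  classical
  have : G.edgeFinset = univ.image fun i => s(v i, v (finRotate n i)) := by
    ext e
    simp only [mem_edgeFinset, mem_image, mem_univ, true_and]
    refine ⟨hv.surjective e, ?_⟩
    rintro ⟨i, rfl⟩
    exact hv.adj i
  rw [this, card_image_of_injective _ hv.injective, card_univ, Fintype.card_fin]

/-- The spanning subgraph formed by the edges at the positions `P`. -/
def edgeSubgraph (v : Fin n → V) (P : Finset (Fin n)) : SimpleGraph V :=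
  fromEdgeSet ((fun i => s(v i, v (finRotate n i))) '' P)

lemma edgeSet_edgeSubgraph (hv : G.IsCyclicEdgeOrder v) (P : Finset (Fin n)) :
    (edgeSubgraph v P).edgeSet = (fun i => s(v i, v (finRotate n i))) '' P := by
  unfold edgeSubgraph
  rw [edgeSet_fromEdgeSet, sdiff_eq_left, Set.disjoint_left]
  rintro _ ⟨i, -, rfl⟩ h
  exact (hv.adj i).ne h

lemma edgeSubgraph_le (hv : G.IsCyclicEdgeOrder v) (P : Finset (Fin n)) :
    edgeSubgraph v P ≤ G := by
  rw [← edgeSet_subset_edgeSet, hv.edgeSet_edgeSubgraph]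
  rintro _ ⟨i, -, rfl⟩
  exact hv.adj i

variable [Fintype V] [DecidableEq V]

/-- An Eulerian circuit passes through a vertex half as often as its degree says. -/
lemma two_mul_card_eq_degree [DecidableRel G.Adj] (hv : G.IsCyclicEdgeOrder v) (u : V) :
    2 * #{i | v i = u} = G.degree u := by
  have h1 : G.incidenceFinset u =
      (univ.filter fun i => v i = u ∨ v (finRotate n i) = u).image
        fun i => s(v i, v (finRotate n i)) := by
    ext e
    simp only [mem_incidenceFinset, mem_image, mem_filter_univ]
    constructor
    · rintro ⟨he, hu⟩
      obtain ⟨i, rfl⟩ := hv.surjective e he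
      rw [Sym2.mem_iff] at hu
      exact ⟨i, by tauto, rfl⟩
    · rintro ⟨i, hi, rfl⟩
      exact ⟨hv.adj i, by rw [Sym2.mem_iff]; tauto⟩
  have h2 : #{i | v (finRotate n i) = u} = #{i | v i = u} :=
    card_equiv (finRotate n) (by simp)
  rw [← card_incidenceFinset_eq_degree, h1, card_image_of_injective _ hv.injective, filter_or,
    card_union_of_disjoint, h2, two_mul]
  rw [disjoint_filter]
  rintro i - rfl h
  exact (hv.adj i).ne h.symm

/-- If no two edges at the positions `P` are consecutive, then each passage of the circuit through
a vertex contributes at most one of them. -/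
lemma degree_edgeSubgraph_le (hv : G.IsCyclicEdgeOrder v) {P : Finset (Fin n)}
    (hP : ∀ i ∈ P, finRotate n i ∉ P) [DecidableRel (edgeSubgraph v P).Adj] (u : V) :
    (edgeSubgraph v P).degree u ≤ #{i | v i = u} := by
  have h1 : (edgeSubgraph v P).incidenceFinset u ⊆
      (P.filter fun i => v i = u ∨ v (finRotate n i) = u).image
        fun i => s(v i, v (finRotate n i)) := by
    intro e he
    rw [mem_incidenceFinset, incidenceSet, Set.mem_sep_iff, hv.edgeSet_edgeSubgraph] at he
    obtain ⟨⟨i, hi, rfl⟩, hu⟩ := he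
    rw [Sym2.mem_iff] at hu
    exact mem_image.2 ⟨i, mem_filter.2 ⟨hi, by tauto⟩, rfl⟩
  rw [← card_incidenceFinset_eq_degree]
  refine (card_le_card h1).trans (card_image_le.trans ?_)
  refine card_le_card_of_injOn (fun i => if v i = u then i else finRotate n i) ?_ ?_
  · intro i hi
    simp only [coe_filter, Set.mem_ofPred_eq, mem_univ, true_and] at hi ⊢
    split_ifs with h
    · exact h
    · tauto
  · intro i hi j hj hij
    simp only [coe_filter, Set.mem_ofPred_eq] at hi hj hij
    split_ifs at hij with h1 h2 h2
    · exact hij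
    · exact absurd (hij ▸ hi.1) (hP j hj.1)
    · exact absurd (hij ▸ hj.1) (hP i hi.1)
    · exact (finRotate n).injective hij

/-- Sufficiently many pairwise nonconsecutive edges of an Eulerian circuit contain a matching with
`r` edges, if there are no short odd cycles. -/
lemma copiesK2_isContained [DecidableRel G.Adj] (hv : G.IsCyclicEdgeOrder v) {D r : ℕ}
    (hreg : G.IsRegularOfDegree (2 * D)) (hr : 0 < r) (hgirth : (2 * r : ℕ) ≤ G.oddGirth)
    {P : Finset (Fin n)} (hP : ∀ i ∈ P, finRotate n i ∉ P) (hcard : D * (r - 1) < #P) :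
    copiesK2 r ⊑ edgeSubgraph v P := by
  classical
  by_cases hbip : (edgeSubgraph v P).IsBipartite
  · refine hbip.copiesK2_isContained (D := D) (fun u => ?_) hr ?_
    · have h1 := hv.degree_edgeSubgraph_le hP u
      have h2 := hv.two_mul_card_eq_degree u
      rw [hreg u] at h2
      omega
    · have : (edgeSubgraph v P).edgeFinset = P.image fun i => s(v i, v (finRotate n i)) := by
        rw [← coe_inj, coe_edgeFinset, hv.edgeSet_edgeSubgraph, coe_image]
      rwa [this, card_image_of_injective _ hv.injective]
  · obtain ⟨w, c, hc, hodd⟩ := exists_isCycle_odd_of_not_isBipartite hbip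
    have hle := hv.edgeSubgraph_le P
    have := oddGirth_le_length (hc.mapLe hle) (by simpa using hodd)
    rw [Walk.length_map] at this
    exact hc.copiesK2_isContained (by exact_mod_cast hgirth.trans this)

end IsCyclicEdgeOrder

end SimpleGraph

/-! ### Alternating classes of positions -/

lemma card_filter_even_rank {n : ℕ} (T : Finset (Fin n)) :
    #{i ∈ T | Even #{j ∈ T | j < i}} = (#T + 1) / 2 := by
  induction T using Finset.induction_on_max with
  | empty => simp
  | insert a T hlt ih =>
    have ha : a ∉ T := fun h => lt_irrefl _ (hlt a h)
    have h1 : {j ∈ insert a T | j < a} = T := by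
      rw [filter_insert, if_neg (lt_irrefl a), filter_true_of_mem hlt]
    have h2 : {i ∈ T | Even #{j ∈ insert a T | j < i}} = {i ∈ T | Even #{j ∈ T | j < i}} := by
      refine filter_congr fun i hi => ?_
      rw [filter_insert, if_neg (hlt i hi).le.not_gt]
    rw [filter_insert, h1, h2, card_insert_of_notMem ha]
    split_ifs with h
    · rw [card_insert_of_notMem (by simp [ha]), ih]
      rw [Nat.even_iff] at h
      omega
    · rw [ih]
      rw [Nat.even_iff] at h
      omega

/-- In a set of even size, cyclically consecutive positions have ranks of different parity. -/
lemma even_rank_finRotate {n : ℕ} {T : Finset (Fin n)} (hT : Even #T) {i : Fin n} (hi : i ∈ T) :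
    Even #{j ∈ T | j < finRotate n i} ↔ ¬ Even #{j ∈ T | j < i} := by
  have hval := val_finRotate i
  split_ifs at hval with h
  · have h1 : {j ∈ T | j < finRotate n i} = ∅ := by
      refine filter_false_of_mem fun j _ => ?_
      rw [Fin.lt_def]
      omega
    have h2 : {j ∈ T | j < i} = T.erase i := by
      ext j
      have := j.2
      simp only [mem_filter, mem_erase, Fin.lt_def, Ne, Fin.ext_iff]
      constructor
      · rintro ⟨h1, h2⟩
        exact ⟨by omega, h1⟩
      · rintro ⟨h1, h2⟩
        exact ⟨h2, by omega⟩
    rw [h1, h2, ← Nat.even_add_one, card_erase_add_one hi]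
    simpa using hT
  · have h1 : {j ∈ T | j < finRotate n i} = insert i {j ∈ T | j < i} := by
      ext j
      simp only [mem_filter, mem_insert, Fin.lt_def, Fin.ext_iff]
      constructor
      · rintro ⟨h1, h2⟩
        by_cases h3 : (j : ℕ) = i
        · exact Or.inl h3
        · exact Or.inr ⟨h1, by omega⟩
      · rintro (h1 | ⟨h1, h2⟩)
        · exact ⟨by rwa [Fin.ext h1], by omega⟩
        · exact ⟨h1, by omega⟩
    rw [h1, card_insert_of_notMem (by simp), Nat.even_add_one]

/-! ### The chromatic number of the graph of matchings -/

namespace SimpleGraph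

variable {V : Type*} {G : SimpleGraph V}

/-- A chord between two vertices at even distance along a cycle would close an odd cycle, which is
impossible if that cycle is shorter than the odd girth. -/
lemma Walk.IsCycle.not_adj_getVert {w : V} {c : G.Walk w w} (hc : c.IsCycle) {l m : ℕ}
    (hlm : l < m) (hm : m < c.length) (heven : Even (m - l))
    (hgirth : ((m - l + 1 : ℕ) : ℕ∞) < G.oddGirth) : ¬ G.Adj (c.getVert m) (c.getVert l) := by
  intro hadj
  have hpath : ((c.take m).drop l).IsPath := (hc.isPath_take hm).drop l
  have hlen : ((c.take m).drop l).length = m - l := by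
    rw [Walk.drop_length, Walk.take_length]
    omega
  have hl : (c.take m).getVert l = c.getVert l := by
    rw [Walk.take_getVert]
    congr 1
    omega
  rw [← hl] at hadj
  have hcyc : (Walk.cons hadj ((c.take m).drop l)).IsCycle := by
    rw [Walk.cons_isCycle_iff]
    refine ⟨hpath, fun h => ?_⟩
    have := hpath.length_eq_one_of_mem_edges (by rwa [Sym2.eq_swap])
    rw [hlen] at this
    simp [this] at heven
  have := oddGirth_le_length hcyc (by
    rw [Walk.length_cons, hlen]
    exact heven.add_one)
  rw [Walk.length_cons, hlen] at this
  exact absurd hgirth (not_lt.2 this)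

/-- A graph that is not bipartite has an independent set of about half the odd girth. -/
lemma exists_isIndepSet_card_eq [DecidableEq V] (hbip : ¬ G.IsBipartite) {r : ℕ}
    (hgirth : (2 * r : ℕ) ≤ G.oddGirth) :
    ∃ I : Finset V, #I = r - 1 ∧ G.IsIndepSet (I : Set V) := by
  obtain ⟨w, c, hc, hodd⟩ := exists_isCycle_odd_of_not_isBipartite hbip
  have hlen : 2 * r ≤ c.length := by exact_mod_cast hgirth.trans (oddGirth_le_length hc hodd)
  have hnot : ∀ i j : Fin (r - 1), i < j → ¬ G.Adj (c.getVert (2 * j)) (c.getVert (2 * i)) := by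
    intro i j hij
    have hj := j.2
    rw [Fin.lt_def] at hij
    refine hc.not_adj_getVert (by omega) (by omega) ⟨j - i, by omega⟩
      (lt_of_lt_of_le (Nat.cast_lt.2 ?_) hgirth)
    omega
  refine ⟨univ.image fun j : Fin (r - 1) => c.getVert (2 * j), ?_, ?_⟩
  · rw [card_image_of_injective, card_univ, Fintype.card_fin]
    intro i j hij
    have hi := i.2
    have hj := j.2
    have := hc.getVert_injOn' (by simp; omega) (by simp; omega) hij
    exact Fin.ext (by omega)
  · intro x hx y hy hxy
    simp only [coe_image, coe_univ, Set.image_univ, Set.mem_range] at hx hy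
    obtain ⟨i, rfl⟩ := hx
    obtain ⟨j, rfl⟩ := hy
    rcases lt_trichotomy i j with h | rfl | h
    · exact fun hadj => hnot i j h hadj.symm
    · exact absurd rfl hxy
    · exact hnot j i h

/-- In a regular graph, the number of edges that avoid an independent set. -/
lemma card_edges_avoiding_add [Fintype V] [DecidableEq V] [DecidableRel G.Adj] {k : ℕ}
    (hreg : G.IsRegularOfDegree k) {I : Finset V} (hI : G.IsIndepSet (I : Set V)) :
    #{e ∈ G.edgeFinset | ∀ x ∈ I, x ∉ e} + k * #I = #G.edgeFinset := by
  rw [← card_filter_add_card_filter_not (s := G.edgeFinset) (fun e => ∀ x ∈ I, x ∉ e)]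
  congr 1
  have : {e ∈ G.edgeFinset | ¬ ∀ x ∈ I, x ∉ e} = I.biUnion fun x => G.incidenceFinset x := by
    ext e
    simp only [mem_filter, mem_edgeFinset, mem_biUnion, mem_incidenceFinset, incidenceSet,
      Set.mem_sep_iff]
    push Not
    tauto
  rw [this, card_biUnion, sum_congr rfl fun x _ => by
    rw [card_incidenceFinset_eq_degree, hreg x], sum_const, smul_eq_mul, mul_comm]
  intro x hx y hy hxy
  rw [Function.onFun, Finset.disjoint_left]
  intro e hex hey
  rw [mem_incidenceFinset] at hex hey
  refine hI hx hy hxy ?_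
  have : e = s(x, y) := (Sym2.mem_and_mem_iff hxy).1 ⟨hex.2, hey.2⟩
  rw [this] at hex
  exact hex.1

lemma exists_subgraph_of_copiesK2_isContained {H : SimpleGraph V} (hle : H ≤ G) {r : ℕ}
    (h : copiesK2 r ⊑ H) :
    ∃ S : {S : G.Subgraph // Nonempty (S.coe ≃g copiesK2 r)}, S.1.edgeSet ⊆ H.edgeSet := by
  obtain ⟨f⟩ := h
  refine ⟨⟨((Copy.ofLE H G hle).comp f).toSubgraph,
    ⟨((Copy.ofLE H G hle).comp f).isoToSubgraph.symm⟩⟩, ?_⟩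
  intro e he
  induction e with
  | _ x y =>
    rw [Subgraph.mem_edgeSet] at he
    simp only [Subgraph.map_adj, Relation.Map, Subgraph.top_adj] at he
    obtain ⟨a, b, hab, rfl, rfl⟩ := he
    exact f.toHom.map_adj hab

/-- A matching with `r` edges has an edge that avoids a given set of fewer than `r` vertices. -/
lemma exists_mem_edgeSet_avoiding {r : ℕ} (S : {S : G.Subgraph // Nonempty (S.coe ≃g copiesK2 r)})
    {I : Finset V} (hI : #I < r) : ∃ e ∈ S.1.edgeSet, ∀ x ∈ I, x ∉ e := by
  obtain ⟨S, ⟨φ⟩⟩ := S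
  by_contra! hno
  have hedge : ∀ i, S.Adj (φ.symm (i, false)) (φ.symm (i, true)) := fun i =>
    (φ.symm.map_adj_iff (v := (i, false)) (w := (i, true))).2 ⟨rfl, Bool.false_ne_true⟩
  have hx : ∀ i, ∃ b, (φ.symm (i, b) : V) ∈ I := fun i => by
    obtain ⟨x, hx, hxe⟩ := hno s(_, _) (hedge i)
    rcases Sym2.mem_iff.1 hxe with rfl | rfl
    · exact ⟨_, hx⟩
    · exact ⟨_, hx⟩
  choose b hb using hx
  have := card_le_card_of_injOn (s := (univ : Finset (Fin r))) (t := I)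
    (fun i => (φ.symm (i, b i) : V)) (fun i _ => hb i) (by
      intro i _ j _ hij
      have := φ.symm.injective (Subtype.ext hij)
      exact congrArg Prod.fst this)
  rw [card_univ, Fintype.card_fin] at this
  omega

/-- The matchings with `r` edges are properly coloured by choosing one of their edges that avoids
a fixed set of fewer than `r` vertices. -/
lemma colorable_generalKneserGraph [Fintype V] [DecidableEq V] [DecidableRel G.Adj] {r : ℕ}
    {I : Finset V} (hI : #I < r) :
    (generalKneserGraph G (copiesK2 r)).Colorable #{e ∈ G.edgeFinset | ∀ x ∈ I, x ∉ e} := by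
  choose e he heI using fun S => exists_mem_edgeSet_avoiding (G := G) (r := r) S hI
  have hmem : ∀ S, e S ∈ ({e ∈ G.edgeFinset | ∀ x ∈ I, x ∉ e} : Finset (Sym2 V)) := fun S => by
    rw [mem_filter, mem_edgeFinset]
    exact ⟨S.1.edgeSet_subset (he S), heI S⟩
  let C : (generalKneserGraph G (copiesK2 r)).Coloring
      ({e ∈ G.edgeFinset | ∀ x ∈ I, x ∉ e} : Finset (Sym2 V)) :=
    Coloring.mk (fun S => ⟨e S, hmem S⟩) fun {S T} hST h => by
      have h : e S = e T := congrArg Subtype.val h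
      exact Set.disjoint_left.1 hST.2 (he S) (h ▸ he T)
  have := C.colorable
  rwa [Fintype.card_coe] at this

/-- The lower bound for the number of colours, by alternating sign vectors on the edges in the order
of an Eulerian circuit. -/
lemma IsCyclicEdgeOrder.le_of_colorable [Fintype V] [DecidableEq V] [DecidableRel G.Adj]
    {n : ℕ} {v : Fin n → V} (hv : G.IsCyclicEdgeOrder v) {D r c : ℕ}
    (hreg : G.IsRegularOfDegree (2 * D)) (hr : 0 < r) (hgirth : (2 * r : ℕ) ≤ G.oddGirth)
    (hc : (generalKneserGraph G (copiesK2 r)).Colorable c) :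
    n ≤ 2 * D * (r - 1) + 1 + (c - 1) := by
  classical
  obtain ⟨C⟩ := hc
  have hclass : ∀ P : Finset (Fin n), (∀ i ∈ P, finRotate n i ∉ P) → D * (r - 1) < #P →
      ∃ S : {S : G.Subgraph // Nonempty (S.coe ≃g copiesK2 r)},
        (univ.filter fun i => s(v i, v (finRotate n i)) ∈ S.1.edgeSet) ⊆ P := by
    intro P hP hcard
    obtain ⟨S, hS⟩ := exists_subgraph_of_copiesK2_isContained (hv.edgeSubgraph_le P)
      (hv.copiesK2_isContained hreg hr hgirth hP hcard)
    refine ⟨S, fun i hi => ?_⟩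
    rw [mem_filter_univ] at hi
    have := hS hi
    rw [hv.edgeSet_edgeSubgraph] at this
    obtain ⟨j, hj, hij⟩ := this
    exact hv.injective hij ▸ hj
  refine card_le_of_alternating
    (supp := fun S : {S : G.Subgraph // Nonempty (S.coe ≃g copiesK2 r)} =>
      univ.filter fun i => s(v i, v (finRotate n i)) ∈ S.1.edgeSet)
    (col := fun S => C S) _ ?_ ?_ ?_
  · intro S T hST
    have hdisj : Disjoint S.1.edgeSet T.1.edgeSet := by
      rw [Set.disjoint_left]
      intro e heS heT
      obtain ⟨i, rfl⟩ := hv.surjective e (S.1.edgeSet_subset heS)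
      exact Finset.disjoint_left.1 hST ((mem_filter_univ _).2 heS) ((mem_filter_univ _).2 heT)
    refine C.valid ⟨?_, hdisj⟩
    rintro rfl
    obtain ⟨e, he, -⟩ := exists_mem_edgeSet_avoiding S (I := ∅) (by simpa using hr)
    exact Set.disjoint_left.1 hdisj he he
  · intro T hT
    have hTe : Even #T := ⟨D * (r - 1) + 1, by rw [hT]; ring⟩
    refine hclass _ (fun i hi hi' => ?_) ?_
    · rw [mem_filter] at hi hi'
      exact (even_rank_finRotate hTe hi.1).1 hi'.2 hi.2
    · rw [card_filter_even_rank, hT, mul_assoc]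
      omega
  · intro T hT
    have hTe : Even #T := ⟨D * (r - 1) + 1, by rw [hT]; ring⟩
    refine hclass _ (fun i hi hi' => ?_) ?_
    · rw [mem_filter] at hi hi'
      exact hi'.2 ((even_rank_finRotate hTe hi.1).2 hi.2)
    · have h1 := card_filter_add_card_filter_not (s := T) (fun i => Even #{j ∈ T | j < i})
      rw [card_filter_even_rank, hT, mul_assoc] at h1
      omega

end SimpleGraph

theorem mainTheorem5 {V : Type*} [Fintype V] [DecidableEq V] (G : SimpleGraph V)
    [DecidableRel G.Adj] (k g r : ℕ)
    (hconn : G.Connected) (hbip : ¬ G.IsBipartite)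
    (hreg : G.IsRegularOfDegree k) (hk : Even k)
    (hg : (g : ℕ∞) ≤ G.oddGirth)
    (hr : 0 < r) (hrg : (r : ℚ) ≤ (g : ℚ) / 2) :
    ∃ c : ℕ, (generalKneserGraph G (copiesK2 r)).chromaticNumber = (c : ℕ∞) ∧
      (c : ℤ) = (G.edgeFinset.card : ℤ) - (k : ℤ) * ((r : ℤ) - 1) := by
  have hgirth : ((2 * r : ℕ) : ℕ∞) ≤ G.oddGirth := by
    refine le_trans (Nat.cast_le.2 ?_) hg
    have : (2 * r : ℚ) ≤ g := by linarith
    exact_mod_cast this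
  obtain ⟨I, hIcard, hI⟩ := SimpleGraph.exists_isIndepSet_card_eq hbip hgirth
  have hcard := SimpleGraph.card_edges_avoiding_add hreg hI
  have hcol := SimpleGraph.colorable_generalKneserGraph (G := G) (r := r) (I := I) (by omega)
  set N := #{e ∈ G.edgeFinset | ∀ x ∈ I, x ∉ e}
  rw [hIcard] at hcard
  refine ⟨N, le_antisymm hcol.chromaticNumber_le ?_, ?_⟩
  · rw [SimpleGraph.le_chromaticNumber_iff_colorable]
    intro c hc
    obtain ⟨D, rfl⟩ := hk.two_dvd
    obtain ⟨u, p, hp⟩ := hconn.exists_isEulerian_circuit fun v => by rw [hreg v]; exact hk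
    have hv := hp.isCyclicEdgeOrder
    have hle := hv.le_of_colorable hreg hr hgirth hc
    rw [← hv.card_edgeFinset] at hle
    -- there is a matching with `r` edges, so the subtraction `c - 1` is not truncated
    have hpos : 0 < c := by
      obtain ⟨w, q, hq, hodd⟩ := SimpleGraph.exists_isCycle_odd_of_not_isBipartite hbip
      obtain ⟨S, -⟩ := SimpleGraph.exists_subgraph_of_copiesK2_isContained le_rfl
        (hq.copiesK2_isContained (r := r)
          (by exact_mod_cast hgirth.trans (SimpleGraph.oddGirth_le_length hq hodd)))
      exact (hc.some S).pos
    omega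
  · rw [← hcard]
    push_cast [Nat.cast_sub hr]
    ring
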